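/- Let $n\ge 1$ and let $\mathcal D$ be the family of dyadic cubes $Q=2^k(m+[0,1]^n)$, $k\in\mathbb Z$, $m\in\mathbb Z^n$, of $\mathbb R^n$. For a locally integrable function $f$ on $\mathbb R^n$ and $Q\in\mathcal D$ write $\langle f\rangle_Q=\frac1{|Q|}\int_Q f$, and for $0<t<\infty$ put $$M_d f(x)=\sup_{x\in Q\in\mathcal D}|\langle f\rangle_Q|,\qquad \|f\|_{H^t_d(\mathbb R^n)}=\|M_d f\|_{L^t(\mathbb R^n)}\in[0,\infty].$$ Let $0<p,q,r,s<\infty$ with $\frac1q=\frac1p+\frac1r$. Then there is a constant $C$, depending only on $n,p,q,r,s$, such that the following holds. Let $\{g_Q\}_{Q\in\mathcal D}$ be nonnegative real numbers, and suppose that $A\ge 0$ is a constant such that $$\Big\|\sum_{Q\in\mathcal D}|\langle f\rangle_Q|^s\,g_Q\,\chi_Q\Big\|_{L^q(\mathbb R^n)}\le A\,\|f\|^s_{H^{sp}_d(\mathbb R^n)}$$ for all compactly supported dyadic step functions $f$ (finite linear combinations, with scalar coefficients, of indicators $\chi_Q$ of dyadic cubes) with $\|f\|_{H^{sp}_d(\mathbb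 R^n)}<\infty$. Then $$\Big\|\sum_{Q\in\mathcal D}g_Q\,\chi_Q\Big\|_{L^r(\mathbb R^n)}\le C\,A .$$ This holds both when the scalars are real and when they are complex. -/

import Mathlib

open MeasureTheory
open scoped ENNReal NNReal

/-- Labels of the dyadic cubes `2 ^ k (m + [0, 1] ^ n)` of `ℝ ^ n`, with `k ∈ ℤ` and `m ∈ ℤ ^ n`
(for `n ≥ 1` different labels give different cubes). -/
structure DyadicCube (n : ℕ) where
  /-- The exponent `k`; the side length is `2 ^ k`. -/
  scale : ℤ
  /-- The integer vector `m`; the lower corner is `2 ^ k m`. -/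
  corner : Fin n → ℤ

namespace DyadicCube

/-- The closed cube `2 ^ k (m + [0, 1] ^ n)`. -/
def toSet {n : ℕ} (Q : DyadicCube n) : Set (Fin n → ℝ) :=
  Set.Icc (fun i => (2 : ℝ) ^ Q.scale * (Q.corner i : ℝ))
    (fun i => (2 : ℝ) ^ Q.scale * ((Q.corner i : ℝ) + 1))

end DyadicCube

/-- Finite linear combinations of indicators of dyadic cubes, that is, the compactly supported
dyadic step functions. -/
def IsDyadicStepFunction {𝕜 : Type*} [RCLike 𝕜] {n : ℕ} (f : (Fin n → ℝ) → 𝕜) : Prop :=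
  ∃ (F : Finset (DyadicCube n)) (c : DyadicCube n → 𝕜),
    f = fun x => ∑ Q ∈ F, Q.toSet.indicator (fun _ => c Q) x

/-- The average of `f` over the dyadic cube `Q` with respect to Lebesgue measure. -/
noncomputable def dyadicAverage {𝕜 : Type*} [RCLike 𝕜] {n : ℕ}
    (f : (Fin n → ℝ) → 𝕜) (Q : DyadicCube n) : 𝕜 :=
  ⨍ x in Q.toSet, f x

/-- The dyadic maximal function `M_d f (x) = sup |⟨f⟩_Q|`, the supremum being over the dyadic
cubes `Q` that contain `x`. -/
noncomputable def dyadicMaximal {𝕜 : Type*} [RCLike 𝕜] {n : ℕ}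
    (f : (Fin n → ℝ) → 𝕜) (x : Fin n → ℝ) : ℝ≥0∞ :=
  ⨆ (Q : DyadicCube n) (_ : x ∈ Q.toSet), ‖dyadicAverage f Q‖ₑ

/-- The dyadic Hardy (quasi-)norm `‖M_d f‖_{L^p}`, with value `∞` when `f` is not in the space. -/
noncomputable def dyadicHardyNorm {𝕜 : Type*} [RCLike 𝕜] {n : ℕ}
    (f : (Fin n → ℝ) → 𝕜) (p : ℝ) : ℝ≥0∞ :=
  eLpNorm (dyadicMaximal f) (ENNReal.ofReal p) volume

/-- The function `∑_Q a_Q χ_Q`, for a family `a` with values in `[0, ∞]`. -/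
noncomputable def dyadicSum {n : ℕ} (a : DyadicCube n → ℝ≥0∞) (x : Fin n → ℝ) : ℝ≥0∞ :=
  ∑' Q : DyadicCube n, Q.toSet.indicator (fun _ => a Q) x

/-! By monotone convergence it suffices to treat the restriction `γ` of `g` to a finite set of
cubes, with a constant independent of that set. Let `Γ_Q` be the sum of `γ` over `Q` and its
ancestors, `Γ` its value at the finest scale, and `I = ∫ Γ ^ r`. The plan is to test the hypothesis
on one `f` with `|⟨f⟩_Q| ^ s ≥ Γ_Q ^ (r / p)` and `‖f‖_{H^{sp}} ^ s ≲ I ^ (1 / p)`. Summing `Γ_Q ^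
(r / p) γ_Q` along a chain of cubes gives at least `(q / r) Γ ^ (r / q)`, so `I ^ (1 / q) ≲ A I ^ (1
/ p)`, and dividing by the finite `I ^ (1 / p)` leaves `I ^ (1 / r) ≲ A`.

To find `f`, let `w` be the running maximum of the martingale generated by `Γ ^ (r / 2)`. It
dominates `Γ_Q ^ (r / 2)`, and `∫ w ^ 2 ≤ 4 I` by Doob. Averages comparable to `w ^ b`, with `b = 2
/ (s p)`, would do, but `w ^ b` is not a martingale, and a positive `f` need not lie in `H^{sp}`
when `s p ≤ 1`. The walk `haarWalk` supplies a mean-zero martingale whose modulus stays comparable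
to `w ^ b` from the first step on (`exists_haarWalk`). The two halves of the estimate are
`dyadicMaximal_le_of_martingale` and `ancestorSum_rpow_le_dyadicSum`; they meet in
`eLpNorm_sum_indicator_le`. -/

namespace DyadicCube

variable {n : ℕ}

/-! ### The tree of dyadic cubes. -/

@[ext]
theorem ext_scale_corner {Q R : DyadicCube n} (h₁ : Q.scale = R.scale)
    (h₂ : Q.corner = R.corner) : Q = R := by
  cases Q; cases R; simp_all

/-- The dyadic parent of a cube. -/
def parent (Q : DyadicCube n) : DyadicCube n :=
  ⟨Q.scale + 1, fun i => Q.corner i / 2⟩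

/-- The `2 ^ n` dyadic children of a cube. -/
def child (Q : DyadicCube n) (e : Fin n → Fin 2) : DyadicCube n :=
  ⟨Q.scale - 1, fun i => 2 * Q.corner i + ((e i : ℕ) : ℤ)⟩

@[simp]
theorem parent_child (Q : DyadicCube n) (e : Fin n → Fin 2) : (Q.child e).parent = Q := by
  ext i
  · simp [parent, child]
  · simp only [parent, child]
    have := (e i).isLt
    omega

theorem exists_child_parent (Q : DyadicCube n) : ∃ e, Q.parent.child e = Q := by
  refine ⟨fun i => ⟨(Q.corner i % 2).toNat, by omega⟩, ?_⟩
  ext i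
  · simp [parent, child]
  · simp only [parent, child]
    omega

theorem finite_preimage_parent {S : Set (DyadicCube n)} (hS : S.Finite) :
    (parent ⁻¹' S).Finite := by
  refine (hS.biUnion fun P _ => Set.finite_range P.child).subset fun Q hQ => ?_
  obtain ⟨e, he⟩ := exists_child_parent Q
  exact Set.mem_biUnion hQ ⟨e, he⟩

theorem finite_preimage_iterate_parent {S : Set (DyadicCube n)} (hS : S.Finite) (j : ℕ) :
    (parent^[j] ⁻¹' S).Finite := by
  induction j with
  | zero => simpa using hS
  | succ j ih =>
    rw [Function.iterate_succ, Set.preimage_comp]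
    exact finite_preimage_parent ih

/-! ### Averages on the tree and tree martingales. -/

/-- The average of a function on cubes over the children of a cube. -/
noncomputable def childAverage (a : DyadicCube n → ℝ) (Q : DyadicCube n) : ℝ :=
  (∑ e, a (Q.child e)) / 2 ^ n

theorem childAverage_mono {a b : DyadicCube n → ℝ} {Q : DyadicCube n}
    (h : ∀ e, a (Q.child e) ≤ b (Q.child e)) : childAverage a Q ≤ childAverage b Q := by
  unfold childAverage
  gcongr with e
  exact h e

theorem childAverage_const {a : DyadicCube n → ℝ} {Q : DyadicCube n} {c : ℝ}
    (h : ∀ e, a (Q.child e) = c) : childAverage a Q = c := by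
  simp [childAverage, h]

/-- Regularity of the dyadic filtration: one nonnegative term is at most the sum over all siblings.
-/
theorem le_childAverage_mul {a : DyadicCube n → ℝ} (ha : ∀ Q, 0 ≤ a Q) (Q : DyadicCube n) :
    a Q ≤ 2 ^ n * childAverage a Q.parent := by
  obtain ⟨e, he⟩ := exists_child_parent Q
  unfold childAverage
  rw [mul_div_cancel₀ _ (by positivity)]
  conv_lhs => rw [← he]
  exact Finset.single_le_sum (f := fun e => a (Q.parent.child e)) (fun e _ => ha _)
    (Finset.mem_univ e)

theorem childAverage_mul_add (a : DyadicCube n → ℝ) (c d : ℝ) (Q : DyadicCube n) :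
    childAverage (fun R => c + d * a R) Q = c + d * childAverage a Q := by
  simp only [childAverage, Finset.sum_add_distrib, ← Finset.mul_sum]
  simp
  field_simp

/-- The average of a function on cubes over the descendants of generation `j` of a cube. -/
noncomputable def treeAverage (j : ℕ) (a : DyadicCube n → ℝ) : DyadicCube n → ℝ :=
  childAverage^[j] a

@[simp]
theorem treeAverage_zero (a : DyadicCube n → ℝ) : treeAverage 0 a = a := rfl

theorem treeAverage_succ (j : ℕ) (a : DyadicCube n → ℝ) :
    treeAverage (j + 1) a = childAverage (treeAverage j a) :=
  Function.iterate_succ_apply' ..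

theorem treeAverage_add (i j : ℕ) (a : DyadicCube n → ℝ) :
    treeAverage (i + j) a = treeAverage i (treeAverage j a) :=
  Function.iterate_add_apply ..

theorem treeAverage_mono (j : ℕ) {a b : DyadicCube n → ℝ} (h : ∀ Q, a Q ≤ b Q)
    (Q : DyadicCube n) : treeAverage j a Q ≤ treeAverage j b Q := by
  induction j generalizing Q with
  | zero => exact h Q
  | succ j ih =>
    simp only [treeAverage_succ]
    exact childAverage_mono fun e => ih _

theorem treeAverage_eq_zero (j : ℕ) {a : DyadicCube n → ℝ} {Q : DyadicCube n}
    (h : ∀ L, parent^[j] L = Q → a L = 0) : treeAverage j a Q = 0 := by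
  induction j generalizing Q with
  | zero => exact h Q rfl
  | succ j ih =>
    rw [treeAverage_succ]
    refine childAverage_const fun e => ih fun L hL => h L ?_
    rw [Function.iterate_succ_apply', hL, parent_child]

theorem treeAverage_nonneg (j : ℕ) {a : DyadicCube n → ℝ} (h : ∀ Q, 0 ≤ a Q)
    (Q : DyadicCube n) : 0 ≤ treeAverage j a Q := by
  rw [← treeAverage_eq_zero j (a := fun _ => 0) (Q := Q) (by simp)]
  exact treeAverage_mono j h Q

theorem treeAverage_add_mul (j : ℕ) (a b : DyadicCube n → ℝ) (c d : ℝ) (Q : DyadicCube n) :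
    treeAverage j (fun R => c * a R + d * b R) Q =
      c * treeAverage j a Q + d * treeAverage j b Q := by
  induction j generalizing Q with
  | zero => rfl
  | succ j ih =>
    simp only [treeAverage_succ, childAverage, ih, Finset.sum_add_distrib, ← Finset.mul_sum]
    ring

/-- A tree martingale is recovered from its last values by averaging. -/
theorem treeAverage_eq_of_martingale {J : ℕ} {Y : ℕ → DyadicCube n → ℝ}
    (hY : ∀ i < J, Y i = childAverage (Y (i + 1))) {j : ℕ} (hj : j ≤ J) :
    treeAverage j (Y J) = Y (J - j) := by
  induction j with
  | zero => rfl
  | succ j ih =>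
    rw [treeAverage_succ, ih (by omega), hY (J - (j + 1)) (by omega)]
    congr 2
    omega

/-- The last values of a tree supermartingale have averages below its first values. -/
theorem treeAverage_le_of_supermartingale {J : ℕ} {Y : ℕ → DyadicCube n → ℝ}
    (hY : ∀ i < J, ∀ Q, childAverage (Y (i + 1)) Q ≤ Y i Q) {j : ℕ} (hj : j ≤ J)
    (Q : DyadicCube n) : treeAverage j (Y J) Q ≤ Y (J - j) Q := by
  induction j generalizing Q with
  | zero => rfl
  | succ j ih =>
    rw [treeAverage_succ]
    refine (childAverage_mono fun e => ih (by omega) _).trans ?_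
    have h := hY (J - (j + 1)) (by omega) Q
    rwa [show J - (j + 1) + 1 = J - j by omega] at h

/-- The last values of a tree submartingale have averages above its first values. -/
theorem le_treeAverage_of_submartingale {J : ℕ} {Y : ℕ → DyadicCube n → ℝ}
    (hY : ∀ i < J, ∀ Q, Y i Q ≤ childAverage (Y (i + 1)) Q) {j : ℕ} (hj : j ≤ J)
    (Q : DyadicCube n) : Y (J - j) Q ≤ treeAverage j (Y J) Q := by
  induction j generalizing Q with
  | zero => rfl
  | succ j ih =>
    rw [treeAverage_succ]
    refine le_trans ?_ (childAverage_mono fun e => ih (by omega) _)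
    have h := hY (J - (j + 1)) (by omega) Q
    rwa [show J - (j + 1) + 1 = J - j by omega] at h

/-! ### Ancestor sums, running maxima and Doob's inequality. -/

/-- The sum of `g` over a cube and its first `i` ancestors. -/
noncomputable def ancestorSum (g : DyadicCube n → ℝ) : ℕ → DyadicCube n → ℝ
  | 0, Q => g Q
  | i + 1, Q => ancestorSum g i Q.parent + g Q

theorem ancestorSum_nonneg {g : DyadicCube n → ℝ} (hg : ∀ Q, 0 ≤ g Q) (i : ℕ)
    (Q : DyadicCube n) : 0 ≤ ancestorSum g i Q := by
  induction i generalizing Q with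
  | zero => exact hg Q
  | succ i ih => exact add_nonneg (ih _) (hg Q)

theorem ancestorSum_eq_zero {g : DyadicCube n → ℝ} {i : ℕ} {Q : DyadicCube n}
    (h : ∀ j ≤ i, g (parent^[j] Q) = 0) : ancestorSum g i Q = 0 := by
  induction i generalizing Q with
  | zero => exact h 0 le_rfl
  | succ i ih =>
    simp only [ancestorSum]
    have h0 : g Q = 0 := h 0 (by omega)
    rw [ih fun j hj => h (j + 1) (by omega), h0, add_zero]

/-- The maximum of the process `X` over a cube and its first `i` ancestors. -/
noncomputable def runningMax (X : ℕ → DyadicCube n → ℝ) : ℕ → DyadicCube n → ℝ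
  | 0, Q => X 0 Q
  | i + 1, Q => max (runningMax X i Q.parent) (X (i + 1) Q)

theorem le_runningMax (X : ℕ → DyadicCube n → ℝ) (i : ℕ) (Q : DyadicCube n) :
    X i Q ≤ runningMax X i Q := by
  cases i with
  | zero => rfl
  | succ i => exact le_max_right _ _

theorem runningMax_parent_le (X : ℕ → DyadicCube n → ℝ) (i : ℕ) (Q : DyadicCube n) :
    runningMax X i Q.parent ≤ runningMax X (i + 1) Q :=
  le_max_left _ _

theorem runningMax_nonneg {X : ℕ → DyadicCube n → ℝ} (hX : ∀ i Q, 0 ≤ X i Q) (i : ℕ)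
    (Q : DyadicCube n) : 0 ≤ runningMax X i Q :=
  (hX i Q).trans (le_runningMax X i Q)

section Martingale

variable {J : ℕ} {X : ℕ → DyadicCube n → ℝ} (hX₀ : ∀ i Q, 0 ≤ X i Q)
  (hX : ∀ i < J, X i = childAverage (X (i + 1)))
include hX₀ hX

/-- This lets a walk whose jump is decided on the parent dominate the maximum on the child. -/
theorem runningMax_succ_le {i : ℕ} (hi : i < J) (Q : DyadicCube n) :
    runningMax X (i + 1) Q ≤ 2 ^ n * runningMax X i Q.parent := by
  have h1 : (1 : ℝ) ≤ 2 ^ n := one_le_pow₀ one_le_two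
  refine max_le (le_mul_of_one_le_left (runningMax_nonneg hX₀ _ _) h1) ?_
  refine (le_childAverage_mul (hX₀ (i + 1)) Q).trans ?_
  rw [← hX i hi]
  gcongr
  exact le_runningMax X i _

theorem runningMax_eq_zero {i : ℕ} (hi : i ≤ J) {Q : DyadicCube n}
    (h : X 0 (parent^[i] Q) = 0) : runningMax X i Q = 0 := by
  induction i generalizing Q with
  | zero => exact h
  | succ i ih =>
    have h1 := runningMax_succ_le hX₀ hX (i := i) (by omega) Q
    rw [ih (by omega) h, mul_zero] at h1
    exact le_antisymm h1 (runningMax_nonneg hX₀ _ _)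

omit hX₀ in
/-- Doob's maximal inequality in `L ^ 2` for tree martingales. -/
theorem treeAverage_runningMax_sq_le (Q : DyadicCube n) :
    treeAverage J (fun L => runningMax X J L ^ 2) Q ≤
      4 * treeAverage J (fun L => X J L ^ 2) Q := by
  -- With `M` the running maximum, `Y = M² - 2MX`. It is a supermartingale: when `X` moves up to a
  -- new maximum `X'`, replacing `M` by `X'` changes `M² - 2MX'` by `-(M - X')²`.
  set Y : ℕ → DyadicCube n → ℝ :=
    fun i R => runningMax X i R ^ 2 + -2 * runningMax X i R * X i R with hYdef
  have hY : ∀ i < J, ∀ R, childAverage (Y (i + 1)) R ≤ Y i R := by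
    intro i hi R
    have h1 : childAverage (Y (i + 1)) R ≤
        childAverage (fun S => runningMax X i R ^ 2 + -2 * runningMax X i R * X (i + 1) S) R := by
      refine childAverage_mono fun e => ?_
      simp only [hYdef, runningMax, parent_child]
      rcases max_cases (runningMax X i R) (X (i + 1) (R.child e)) with ⟨h, _⟩ | ⟨h, _⟩
      · rw [h]
      · rw [h]
        nlinarith [sq_nonneg (runningMax X i R - X (i + 1) (R.child e))]
    rw [childAverage_mul_add, ← hX i hi] at h1
    exact h1
  have h2 := treeAverage_le_of_supermartingale hY le_rfl Q
  have h3 : Y (J - J) Q ≤ 0 := by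
    simp only [hYdef, Nat.sub_self, runningMax]
    nlinarith [sq_nonneg (X 0 Q)]
  -- Completing the square, `Y - (M² / 2 - 2X²) = (M - 2X)² / 2`; hence the constant 4.
  have h4 : treeAverage J (fun L => (1 / 2) * (runningMax X J L ^ 2) + (-2) * (X J L ^ 2)) Q ≤
      treeAverage J (Y J) Q := by
    refine treeAverage_mono J (fun L => ?_) Q
    simp only [hYdef]
    nlinarith [sq_nonneg (runningMax X J L - 2 * X J L)]
  rw [treeAverage_add_mul] at h4
  linarith

end Martingale

/-! ### The Haar walk. -/

/-- The sign taken on a cube by the Haar function of its parent in the first coordinate. -/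
noncomputable def haarSign [NeZero n] (Q : DyadicCube n) : ℝ :=
  if Even (Q.corner 0) then 1 else -1

theorem childAverage_haarSign [NeZero n] (Q : DyadicCube n) : childAverage haarSign Q = 0 := by
  -- Translation by the all-ones vector pairs each child with one of opposite sign.
  have key : ∀ e : Fin n → Fin 2, haarSign (Q.child (e + 1)) = -haarSign (Q.child e) := by
    intro e
    simp only [haarSign, child, Pi.add_apply, Pi.one_apply]
    have h0 : ¬ Odd (2 * Q.corner 0) := Int.not_odd_iff_even.2 (even_two_mul _)
    rcases Fin.exists_fin_two.mp ⟨e 0, rfl⟩ with h | h <;> simp [h, h0, parity_simps]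
  have h : ∑ e, haarSign (Q.child e) = -∑ e, haarSign (Q.child e) := by
    rw [← Finset.sum_neg_distrib, ← Equiv.sum_comp (Equiv.addRight (1 : Fin n → Fin 2))]
    exact Finset.sum_congr rfl fun e _ => key e
  simp only [childAverage]
  rw [show ∑ e, haarSign (Q.child e) = 0 by linarith, zero_div]

theorem haarSign_eq [NeZero n] (Q : DyadicCube n) : haarSign Q = 1 ∨ haarSign Q = -1 := by
  unfold haarSign
  split_ifs <;> simp

/-- A martingale that starts at `0` and jumps, with both signs, whenever its modulus is below
`κ v`. -/
noncomputable def haarWalk [NeZero n] (κ : ℝ) (v : ℕ → DyadicCube n → ℝ) :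
    ℕ → DyadicCube n → ℝ
  | 0, _ => 0
  | i + 1, Q => haarWalk κ v i Q.parent +
      (if |haarWalk κ v i Q.parent| < κ * v i Q.parent then
        |haarWalk κ v i Q.parent| + κ * v i Q.parent else 0) * haarSign Q

theorem haarWalk_eq_childAverage [NeZero n] (κ : ℝ) (v : ℕ → DyadicCube n → ℝ) (i : ℕ) :
    haarWalk κ v i = childAverage (haarWalk κ v (i + 1)) := by
  funext Q
  trans childAverage (fun R => haarWalk κ v i Q +
      (if |haarWalk κ v i Q| < κ * v i Q then
        |haarWalk κ v i Q| + κ * v i Q else 0) * haarSign R) Q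
  · rw [childAverage_mul_add, childAverage_haarSign, mul_zero, add_zero]
  · simp only [childAverage, haarWalk, parent_child]

section HaarWalk

variable [NeZero n] {κ : ℝ} {v : ℕ → DyadicCube n → ℝ} (hκ : 0 ≤ κ)
  (hv₀ : ∀ i Q, 0 ≤ v i Q) (hv₁ : ∀ i Q, v i Q.parent ≤ v (i + 1) Q)
include hκ hv₀ hv₁

/-- A jump starts from modulus below `κ v`, so it ends with modulus at most `2 |φ| + κ v ≤ 3 κ v`;
between jumps the bound persists because `v` increases down the tree. -/
theorem abs_haarWalk_le (i : ℕ) (Q : DyadicCube n) : |haarWalk κ v i Q| ≤ 3 * κ * v i Q := by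
  induction i generalizing Q with
  | zero =>
    have := hv₀ 0 Q
    simp only [haarWalk, abs_zero]
    positivity
  | succ i ih =>
    have hm : 3 * κ * v i Q.parent ≤ 3 * κ * v (i + 1) Q := by
      gcongr
      exact hv₁ i Q
    refine le_trans ?_ hm
    have h1 := ih Q.parent
    have hb := abs_nonneg (haarWalk κ v i Q.parent)
    simp only [haarWalk]
    split_ifs with h
    · have hab : 0 ≤ |haarWalk κ v i Q.parent| + κ * v i Q.parent := by linarith
      refine (abs_add_le _ _).trans ?_
      rcases haarSign_eq Q with hs | hs <;> rw [hs] <;> simp only [mul_one, mul_neg, abs_neg] <;>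
        rw [abs_of_nonneg hab] <;> linarith
    · simpa using h1

-- The jump size contains `|φ|`, so with either sign the walk lands at modulus at least `κ v`, even
-- when it has to cross `0`.
omit hκ hv₀ hv₁ in
theorem le_abs_haarWalk {i : ℕ} {Q : DyadicCube n} (hv : v (i + 1) Q ≤ κ * v i Q.parent) :
    v (i + 1) Q ≤ |haarWalk κ v (i + 1) Q| := by
  refine hv.trans ?_
  simp only [haarWalk]
  split_ifs with h
  · have h1 := neg_abs_le (haarWalk κ v i Q.parent)
    have h2 := le_abs_self (haarWalk κ v i Q.parent)
    rcases haarSign_eq Q with hs | hs <;> rw [hs]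
    · exact le_trans (by linarith) (le_abs_self _)
    · exact le_trans (by linarith) (neg_le_abs _)
  · simpa using not_lt.1 h

end HaarWalk

/-! ### Half-open cells, and integrals as tree averages. -/

/-- The dyadic cube of scale `k` whose half-open version contains `x`. -/
noncomputable def cubeAt (k : ℤ) (x : Fin n → ℝ) : DyadicCube n :=
  ⟨k, fun i => ⌊x i / (2 : ℝ) ^ k⌋⟩

@[simp]
theorem scale_cubeAt (k : ℤ) (x : Fin n → ℝ) : (cubeAt k x).scale = k := rfl

theorem parent_cubeAt (k : ℤ) (x : Fin n → ℝ) : (cubeAt k x).parent = cubeAt (k + 1) x := by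
  ext i
  · rfl
  · simp only [cubeAt, parent]
    rw [zpow_add_one₀ two_ne_zero, ← div_div]
    exact_mod_cast (Int.floor_div_natCast (x i / (2 : ℝ) ^ k) 2).symm

theorem iterate_parent_cubeAt (k : ℤ) (x : Fin n → ℝ) (j : ℕ) :
    parent^[j] (cubeAt k x) = cubeAt (k + j) x := by
  induction j with
  | zero => simp
  | succ j ih =>
    rw [Function.iterate_succ_apply', ih, parent_cubeAt]
    push_cast
    rw [add_assoc]

/-- The half-open version of a dyadic cube. -/
def cell (Q : DyadicCube n) : Set (Fin n → ℝ) := {x | cubeAt Q.scale x = Q}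

theorem cell_eq_pi (Q : DyadicCube n) : Q.cell = Set.univ.pi fun i =>
    Set.Ico ((2 : ℝ) ^ Q.scale * (Q.corner i : ℝ)) ((2 : ℝ) ^ Q.scale * ((Q.corner i : ℝ) + 1)) := by
  ext x
  have h2 : (0 : ℝ) < 2 ^ Q.scale := by positivity
  have : x ∈ Q.cell ↔ ∀ i, ⌊x i / (2 : ℝ) ^ Q.scale⌋ = Q.corner i := by
    refine ⟨fun h i => congrFun (congrArg corner h) i, fun h => ?_⟩
    ext i
    · rfl
    · exact h i
  rw [this, Set.mem_univ_pi]
  refine forall_congr' fun i => ?_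
  rw [Int.floor_eq_iff, le_div_iff₀ h2, div_lt_iff₀ h2, Set.mem_Ico, mul_comm, mul_comm _ (2 ^ _)]

theorem measurableSet_cell (Q : DyadicCube n) : MeasurableSet Q.cell := by
  rw [cell_eq_pi]
  exact MeasurableSet.univ_pi fun i => measurableSet_Ico

theorem cell_subset_toSet (Q : DyadicCube n) : Q.cell ⊆ Q.toSet := by
  rw [cell_eq_pi, toSet, ← Set.pi_univ_Icc]
  exact Set.pi_mono fun i _ => Set.Ico_subset_Icc_self

theorem cell_ae_eq_toSet (Q : DyadicCube n) : Q.cell =ᵐ[volume] Q.toSet := by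
  rw [cell_eq_pi]
  exact Measure.univ_pi_Ico_ae_eq_Icc

theorem volume_cell (Q : DyadicCube n) :
    volume Q.cell = ENNReal.ofReal (((2 : ℝ) ^ Q.scale) ^ n) := by
  rw [cell_eq_pi, Real.volume_pi_Ico]
  simp only [mul_add, mul_one, add_sub_cancel_left, Finset.prod_const, Finset.card_univ,
    Fintype.card_fin]
  rw [ENNReal.ofReal_pow (by positivity)]

theorem volume_real_cell (Q : DyadicCube n) :
    volume.real Q.cell = ((2 : ℝ) ^ Q.scale) ^ n := by
  rw [measureReal_def, volume_cell, ENNReal.toReal_ofReal (by positivity)]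

theorem cell_eq_iUnion_child (Q : DyadicCube n) : Q.cell = ⋃ e, (Q.child e).cell := by
  ext x
  simp only [Set.mem_iUnion]
  constructor
  · intro h
    obtain ⟨e, he⟩ := exists_child_parent (cubeAt (Q.scale - 1) x)
    rw [parent_cubeAt, sub_add_cancel, show cubeAt Q.scale x = Q from h] at he
    exact ⟨e, he.symm⟩
  · rintro ⟨e, he⟩
    have h := congrArg parent (show cubeAt (Q.scale - 1) x = Q.child e from he)
    rwa [parent_cubeAt, sub_add_cancel, parent_child] at h

theorem child_injective (Q : DyadicCube n) : Function.Injective Q.child := by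
  intro e e' h
  funext i
  have := congrFun (congrArg corner h) i
  simp only [child] at this
  omega

theorem disjoint_cell {Q R : DyadicCube n} (hs : Q.scale = R.scale) (h : Q ≠ R) :
    Disjoint Q.cell R.cell := by
  refine Set.disjoint_left.2 fun x hx hx' => h ?_
  rw [← show cubeAt Q.scale x = Q from hx, ← show cubeAt R.scale x = R from hx', hs]

instance : Countable (DyadicCube n) := by
  have : Function.Injective fun Q : DyadicCube n => (Q.scale, Q.corner) := by
    intro Q R h
    simp only [Prod.mk.injEq] at h
    exact ext_scale_corner h.1 h.2
  exact this.countable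

/-- Boundaries are null, so almost everywhere the closed cubes containing `x` form the single chain
`cubeAt k x`, `k ∈ ℤ`. -/
theorem ae_mem_toSet_iff :
    ∀ᵐ x : Fin n → ℝ, ∀ Q : DyadicCube n, x ∈ Q.toSet ↔ cubeAt Q.scale x = Q :=
  ae_all_iff.2 fun Q => (cell_ae_eq_toSet Q).mem_iff.mono fun _ h => h.symm

theorem integrableOn_integral_cell (a : DyadicCube n → ℝ) (j : ℕ) (Q : DyadicCube n) :
    IntegrableOn (fun x => a (cubeAt (Q.scale - j) x)) Q.cell ∧
    ∫ x in Q.cell, a (cubeAt (Q.scale - j) x) = ((2 : ℝ) ^ Q.scale) ^ n * treeAverage j a Q := by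
  induction j generalizing Q with
  | zero =>
    have h : Set.EqOn (fun x => a (cubeAt (Q.scale - (0 : ℕ)) x)) (fun _ => a Q) Q.cell := by
      intro x hx
      simp only [Nat.cast_zero, sub_zero]
      rw [show cubeAt Q.scale x = Q from hx]
    constructor
    · refine (integrableOn_congr_fun h (measurableSet_cell Q)).2 (integrableOn_const ?_)
      rw [volume_cell]
      exact ENNReal.ofReal_ne_top
    · rw [setIntegral_congr_fun (measurableSet_cell Q) h, setIntegral_const, volume_real_cell]
      simp
  | succ j ih =>
    have hs : ∀ e, (Q.child e).scale - (j : ℤ) = Q.scale - (j + 1 : ℕ) := by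
      intro e
      simp only [child]
      push_cast
      ring
    have h1 : ∀ e, IntegrableOn (fun x => a (cubeAt (Q.scale - (j + 1 : ℕ)) x))
        (Q.child e).cell := fun e => by
      have := (ih (Q.child e)).1
      rwa [hs e] at this
    have h2 : ∀ e, ∫ x in (Q.child e).cell, a (cubeAt (Q.scale - (j + 1 : ℕ)) x) =
        ((2 : ℝ) ^ (Q.scale - 1)) ^ n * treeAverage j a (Q.child e) := fun e => by
      have := (ih (Q.child e)).2
      rwa [hs e] at this
    have hd : Pairwise (Function.onFun Disjoint fun e => (Q.child e).cell) := by
      intro e e' he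
      have h : Q.child e ≠ Q.child e' := Q.child_injective.ne he
      exact disjoint_cell rfl h
    rw [cell_eq_iUnion_child]
    constructor
    · exact integrableOn_finite_iUnion.2 h1
    · rw [integral_iUnion_fintype (fun e => measurableSet_cell _)
        hd h1]
      simp only [h2]
      rw [treeAverage_succ, childAverage, ← Finset.mul_sum, zpow_sub_one₀ two_ne_zero, mul_pow,
        inv_pow]
      ring

theorem setLIntegral_cell {a : DyadicCube n → ℝ} (ha : ∀ Q, 0 ≤ a Q) (j : ℕ)
    (Q : DyadicCube n) :
    ∫⁻ x in Q.cell, ENNReal.ofReal (a (cubeAt (Q.scale - j) x)) =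
      ENNReal.ofReal (((2 : ℝ) ^ Q.scale) ^ n * treeAverage j a Q) := by
  obtain ⟨h1, h2⟩ := integrableOn_integral_cell a j Q
  rw [← h2, ofReal_integral_eq_lintegral_ofReal h1 (Filter.Eventually.of_forall fun x => ha _)]

/-- The cells of scale `k + j` partition the space, and the integral over each is a multiple of a
tree average. -/
theorem lintegral_le_of_treeAverage_le {a b : DyadicCube n → ℝ} (ha : ∀ Q, 0 ≤ a Q)
    (hb : ∀ Q, 0 ≤ b Q) (j : ℕ) (h : ∀ Q, treeAverage j a Q ≤ treeAverage j b Q) (k : ℤ) :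
    ∫⁻ x, ENNReal.ofReal (a (cubeAt k x)) ≤ ∫⁻ x, ENNReal.ofReal (b (cubeAt k x)) := by
  have key : ∀ F : (Fin n → ℝ) → ℝ≥0∞, ∫⁻ x, F x =
      ∑' m : Fin n → ℤ, ∫⁻ x in (⟨k + j, m⟩ : DyadicCube n).cell, F x := by
    intro F
    rw [← lintegral_iUnion (s := fun m : Fin n → ℤ => cell ⟨k + j, m⟩)
      (fun m => measurableSet_cell _)
      (fun m m' hm => disjoint_cell rfl fun h => hm (congrArg corner h)),
      ← setLIntegral_univ]
    congr 2
    exact (Set.eq_univ_of_forall fun x => Set.mem_iUnion.2 ⟨(cubeAt (k + j) x).corner, rfl⟩).symm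
  rw [key, key]
  refine ENNReal.tsum_le_tsum fun m => ?_
  have h1 := setLIntegral_cell ha j ⟨k + j, m⟩
  have h2 := setLIntegral_cell hb j ⟨k + j, m⟩
  simp only [add_sub_cancel_right] at h1 h2
  rw [h1, h2]
  gcongr
  exact h _

theorem dyadicAverage_eq {𝕜 : Type*} [RCLike 𝕜] {f : (Fin n → ℝ) → 𝕜} {a : DyadicCube n → ℝ}
    {k : ℤ} (hf : f =ᵐ[volume] fun x => (a (cubeAt k x) : 𝕜)) (j : ℕ) {Q : DyadicCube n}
    (hQ : Q.scale = k + j) : dyadicAverage f Q = (treeAverage j a Q : 𝕜) := by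
  have hk : Q.scale - j = k := by omega
  have h := (integrableOn_integral_cell a j Q).2
  rw [hk] at h
  rw [dyadicAverage, ← setAverage_congr (cell_ae_eq_toSet Q), setAverage_eq,
    setIntegral_congr_ae (g := fun x => (a (cubeAt k x) : 𝕜)) (measurableSet_cell Q)
      (hf.mono fun x hx _ => hx), integral_ofReal, h, volume_real_cell]
  rw [RCLike.real_smul_eq_coe_mul, ← RCLike.ofReal_mul]
  congr 1
  field_simp

theorem dyadicAverage_cubeAt_of_le {𝕜 : Type*} [RCLike 𝕜] {f : (Fin n → ℝ) → 𝕜}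
    {a : DyadicCube n → ℝ} {k : ℤ} (hf : f =ᵐ[volume] fun x => (a (cubeAt k x) : 𝕜)) {l : ℤ}
    (hl : l ≤ k) (x : Fin n → ℝ) :
    dyadicAverage f (cubeAt l x) = (a (cubeAt k x) : 𝕜) := by
  obtain ⟨j, rfl⟩ := Int.le.dest hl
  rw [dyadicAverage, ← setAverage_congr (cell_ae_eq_toSet _), setAverage_eq,
    setIntegral_congr_ae (g := fun _ => (a (cubeAt (l + j) x) : 𝕜)) (measurableSet_cell _)
      (hf.mono fun y hy hy' => ?_), setIntegral_const, volume_real_cell, smul_smul,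
      inv_mul_cancel₀ (by positivity), one_smul]
  simp only [hy]
  rw [← iterate_parent_cubeAt, show cubeAt l y = cubeAt l x from hy', iterate_parent_cubeAt]

theorem ae_eq_sum_indicator {E : Type*} [AddCommMonoid E] (a : DyadicCube n → E) {k : ℤ}
    {S : Finset (DyadicCube n)} (hS : ∀ Q ∈ S, Q.scale = k)
    (ha : ∀ Q, Q.scale = k → a Q ≠ 0 → Q ∈ S) :
    (fun x => ∑ Q ∈ S, Q.toSet.indicator (fun _ => a Q) x) =ᵐ[volume]
      fun x => a (cubeAt k x) := by
  classical
  filter_upwards [ae_mem_toSet_iff (n := n)] with x hx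
  have h1 : ∀ Q ∈ S, Q.toSet.indicator (fun _ => a Q) x =
      if Q = cubeAt k x then a (cubeAt k x) else 0 := by
    intro Q hQ
    rw [Set.indicator_apply]
    simp only [hx, hS Q hQ, eq_comm (a := cubeAt k x)]
    split_ifs with h
    · rw [h]
    · rfl
  rw [Finset.sum_congr rfl h1, Finset.sum_ite_eq']
  split_ifs with h
  · rfl
  · by_contra h'
    exact h (ha _ rfl (Ne.symm h'))

theorem ancestorSum_cubeAt (g : DyadicCube n → ℝ) (k : ℤ) (i : ℕ) (x : Fin n → ℝ) :
    ancestorSum g i (cubeAt k x) = ∑ j ∈ Finset.range (i + 1), g (cubeAt (k + j) x) := by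
  induction i generalizing k with
  | zero => simp [ancestorSum]
  | succ i ih =>
    rw [ancestorSum, parent_cubeAt, ih, Finset.sum_range_succ' _ (i + 1)]
    simp only [Nat.cast_zero, add_zero, Nat.cast_add, Nat.cast_one]
    congr 1
    refine Finset.sum_congr rfl fun j _ => ?_
    rw [add_assoc, add_comm (1 : ℤ)]

/-! ### Construction of the test martingale. -/

/-- For a finitely supported family `g` there is a tree martingale `φ` whose modulus is comparable
to a power of a maximal function `w` dominating the partial sums of `g`. -/
theorem exists_haarWalk [NeZero n] {g : DyadicCube n → ℝ} (hg : ∀ Q, 0 ≤ g Q)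
    (hfin : {Q | g Q ≠ 0}.Finite) {b r : ℝ} (hb : 0 < b) (hr : 0 < r) (J : ℕ) :
    ∃ w φ : ℕ → DyadicCube n → ℝ,
      (∀ i Q, 0 ≤ w i Q) ∧ (∀ i Q, w i Q.parent ≤ w (i + 1) Q) ∧
      (∀ i ≤ J, ∀ Q, ancestorSum g i Q ^ (r / 2) ≤ w i Q) ∧
      (∀ Q, treeAverage J (fun L => w J L ^ 2) Q ≤
        4 * treeAverage J (fun L => ancestorSum g J L ^ r) Q) ∧
      (∀ i, φ i = childAverage (φ (i + 1))) ∧ φ 0 = 0 ∧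
      (∀ i Q, |φ i Q| ≤ 3 * ((2 : ℝ) ^ n) ^ b * w i Q ^ b) ∧
      (∀ i < J, ∀ Q, w (i + 1) Q ^ b ≤ |φ (i + 1) Q|) ∧
      ∃ T : Set (DyadicCube n), T.Finite ∧
        ∀ Q, parent^[J] Q ∉ T → ancestorSum g J Q = 0 ∧ φ J Q = 0 := by
  have hΓ := ancestorSum_nonneg hg
  -- The exponent makes `h ^ 2 = Γ ^ r`, so Doob in `L ^ 2` serves every `r > 0`.
  set h : DyadicCube n → ℝ := fun L => ancestorSum g J L ^ (r / 2) with hh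
  have hh₀ : ∀ L, 0 ≤ h L := fun L => Real.rpow_nonneg (hΓ _ _) _
  set X : ℕ → DyadicCube n → ℝ := fun i => treeAverage (J - i) h with hXdef
  have hX₀ : ∀ i Q, 0 ≤ X i Q := fun i Q => treeAverage_nonneg _ hh₀ Q
  have hX : ∀ i < J, X i = childAverage (X (i + 1)) := by
    intro i hi
    simp only [hXdef]
    rw [← treeAverage_succ]
    congr 1
    omega
  have hXJ : X J = h := by simp [hXdef]
  have hw₀ := runningMax_nonneg hX₀
  set w := runningMax X
  set v : ℕ → DyadicCube n → ℝ := fun i Q => w i Q ^ b with hv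
  have hv₀ : ∀ i Q, 0 ≤ v i Q := fun i Q => Real.rpow_nonneg (hw₀ i Q) _
  have hw₁ := runningMax_parent_le X
  have hv₁ : ∀ i Q, v i Q.parent ≤ v (i + 1) Q := fun i Q =>
    Real.rpow_le_rpow (hw₀ _ _) (hw₁ i Q) hb.le
  -- The walk uses `κ = (2 ^ n) ^ b`, the factor of `runningMax_succ_le` raised to the power `b`.
  have hκ : (0 : ℝ) ≤ ((2 : ℝ) ^ n) ^ b := by positivity
  have hφ := abs_haarWalk_le hκ hv₀ hv₁
  refine ⟨w, haarWalk (((2 : ℝ) ^ n) ^ b) v, hw₀, hw₁, ?_, ?_, haarWalk_eq_childAverage _ _, rfl,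
    hφ, ?_, ?_⟩
  · intro i hi Q
    refine le_trans ?_ (le_runningMax X i Q)
    -- Ancestor sums grow from parent to child, so their powers form a submartingale.
    have := le_treeAverage_of_submartingale (J := J)
      (Y := fun i Q => ancestorSum g i Q ^ (r / 2)) (fun i _ Q => ?_) (j := J - i) (by omega) Q
    · simpa [Nat.sub_sub_self hi] using this
    · rw [← childAverage_const (a := fun _ => ancestorSum g i Q ^ (r / 2)) (Q := Q)
        (fun _ => rfl)]
      refine childAverage_mono fun e => Real.rpow_le_rpow (hΓ _ _) ?_ (by positivity)
      simp only [ancestorSum, parent_child]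
      exact le_add_of_nonneg_right (hg _)
  · intro Q
    have := treeAverage_runningMax_sq_le hX Q
    rw [hXJ] at this
    convert this using 4 with L
    rw [hh, ← Real.rpow_natCast, ← Real.rpow_mul (hΓ _ _)]
    norm_num
  · intro i hi Q
    refine le_abs_haarWalk (v := v) ?_
    simp only [hv]
    rw [← Real.mul_rpow (by positivity) (hw₀ _ _)]
    exact Real.rpow_le_rpow (hw₀ _ _) (runningMax_succ_le hX₀ hX hi Q) hb.le
  · refine ⟨⋃ i ∈ Finset.range (J + 1), parent^[i] '' {Q | g Q ≠ 0},
      (Finset.range (J + 1)).finite_toSet.biUnion fun i _ => hfin.image _, ?_⟩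
    have hΓ0 : ∀ Q : DyadicCube n, parent^[J] Q ∉
        (⋃ i ∈ Finset.range (J + 1), parent^[i] '' {Q | g Q ≠ 0}) → ancestorSum g J Q = 0 := by
      refine fun Q hQ => ancestorSum_eq_zero fun j hj => ?_
      by_contra hne
      refine hQ (Set.mem_biUnion (x := J - j) (by simp) ⟨_, hne, ?_⟩)
      rw [← Function.iterate_add_apply, Nat.sub_add_cancel hj]
    refine fun Q hQ => ⟨hΓ0 Q hQ, ?_⟩
    -- If the generation-`J` ancestor is outside `T`, then `h` vanishes on all its generation-`J`
    -- descendants, hence so does the maximum.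
    have hwJ : w J Q = 0 := by
      refine runningMax_eq_zero hX₀ hX le_rfl (treeAverage_eq_zero _ fun L hL => ?_)
      simp only [hh]
      rw [hΓ0 L (by rwa [show parent^[J] L = _ from hL]), Real.zero_rpow (by positivity)]
    have := hφ J Q
    simp only [hv, hwJ, Real.zero_rpow hb.ne', mul_zero] at this
    exact abs_nonpos_iff.1 this

/-! ### Summation along a chain of cubes. -/

/-- The convex function `t ^ (a + 1)` lies above its tangent at the right endpoint `y`; after
scaling this is Bernoulli's inequality. -/
theorem rpow_add_one_sub_le {x y a : ℝ} (hx : 0 ≤ x) (hxy : x ≤ y) (ha : 0 ≤ a) :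
    y ^ (a + 1) ≤ x ^ (a + 1) + (a + 1) * (y ^ a * (y - x)) := by
  rcases hx.eq_or_lt with rfl | hx'
  · rcases hxy.eq_or_lt with rfl | hy
    · simp [Real.zero_rpow (by positivity : a + 1 ≠ 0)]
    · rw [Real.rpow_add_one hy.ne']
      have := Real.rpow_nonneg hy.le a
      have := Real.rpow_nonneg (le_refl (0 : ℝ)) (a + 1)
      nlinarith [mul_nonneg ha (mul_nonneg ‹0 ≤ y ^ a› hy.le)]
  · have hy := hx'.trans_le hxy
    have h := one_add_mul_self_le_rpow_one_add (s := x / y - 1) (p := a + 1)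
      (by linarith [div_nonneg hx hy.le]) (by linarith)
    rw [add_sub_cancel, Real.div_rpow hx hy.le, le_div_iff₀ (by positivity)] at h
    have e : y ^ (a + 1) = y ^ a * y := Real.rpow_add_one hy.ne' a
    have e2 : (1 + (a + 1) * (x / y - 1)) * y ^ (a + 1) =
        y ^ (a + 1) - (a + 1) * (y ^ a * (y - x)) := by
      rw [e]
      field_simp
      ring
    linarith

/-- Discrete form of `G ^ (a + 1) = (a + 1) ∫ G ^ a dG`; the right endpoint gives an upper sum. -/
theorem rpow_add_one_le_sum {G d : ℕ → ℝ} {a : ℝ} (ha : 0 ≤ a) (h₀ : G 0 = 0)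
    (hd : ∀ i, 0 ≤ d i) (hG : ∀ i, G (i + 1) = G i + d i) (J : ℕ) :
    G J ^ (a + 1) ≤ (a + 1) * ∑ i ∈ Finset.range J, G (i + 1) ^ a * d i := by
  have hG₀ : ∀ i, 0 ≤ G i := by
    intro i
    induction i with
    | zero => exact h₀.ge
    | succ i ih => exact hG i ▸ add_nonneg ih (hd i)
  induction J with
  | zero => simp [h₀, Real.zero_rpow (by positivity : a + 1 ≠ 0)]
  | succ J ih =>
    rw [Finset.sum_range_succ, mul_add]
    have h := rpow_add_one_sub_le (hG₀ J) (by linarith [hG J, hd J] : G J ≤ G (J + 1)) ha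
    rw [show G (J + 1) - G J = d J by linarith [hG J]] at h
    linarith

theorem sum_cubeAt_le_dyadicSum (a : DyadicCube n → ℝ≥0∞) (k : ℤ) (J : ℕ) (x : Fin n → ℝ) :
    ∑ i ∈ Finset.range J, a (cubeAt (k - (i + 1 : ℕ)) x) ≤ dyadicSum a x := by
  have hinj : Function.Injective fun i : ℕ => cubeAt (k - (i + 1 : ℕ)) x := by
    intro i j h
    have := congrArg scale h
    simp only [scale_cubeAt] at this
    omega
  refine le_trans ?_ (ENNReal.tsum_comp_le_tsum_of_injective hinj _)
  refine le_trans (le_of_eq (Finset.sum_congr rfl fun i _ => ?_)) (ENNReal.sum_le_tsum _)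
  rw [Set.indicator_of_mem]
  exact cell_subset_toSet _ rfl

theorem sum_indicator_le_ancestorSum {g : DyadicCube n → ℝ≥0} {F : Finset (DyadicCube n)}
    {k : ℤ} {J : ℕ} (hF : ∀ Q ∈ F, k ≤ Q.scale ∧ Q.scale ≤ k + J) :
    ∀ᵐ x : Fin n → ℝ, ∑ Q ∈ F, Q.toSet.indicator (fun _ => (g Q : ℝ≥0∞)) x ≤
      ENNReal.ofReal (ancestorSum ((F : Set (DyadicCube n)).indicator fun Q => (g Q : ℝ)) J
        (cubeAt k x)) := by
  classical
  filter_upwards [ae_mem_toSet_iff (n := n)] with x hx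
  rw [ancestorSum_cubeAt]
  have h1 : ∀ j ∈ Finset.range (J + 1), (0 : ℝ) ≤
      (F : Set (DyadicCube n)).indicator (fun Q => (g Q : ℝ)) (cubeAt (k + j) x) :=
    fun j _ => Set.indicator_nonneg (fun _ _ => NNReal.coe_nonneg _) _
  rw [ENNReal.ofReal_sum_of_nonneg h1]
  simp only [Set.indicator_apply, hx]
  rw [← Finset.sum_filter]
  have hinj : Function.Injective fun j : ℕ => cubeAt (k + j) x := by
    intro i j h
    have := congrArg scale h
    simp only [scale_cubeAt] at this
    omega
  rw [← Finset.sum_image (f := fun Q => ENNReal.ofReal (if Q ∈ (F : Set (DyadicCube n)) then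
    (g Q : ℝ) else 0)) hinj.injOn]
  refine le_trans (le_of_eq (Finset.sum_congr rfl fun Q hQ => ?_))
    (Finset.sum_le_sum_of_subset (s := F.filter fun Q => cubeAt Q.scale x = Q) fun Q hQ => ?_)
  · simp [(Finset.mem_filter.1 hQ).1]
  · obtain ⟨hQF, hQx⟩ := Finset.mem_filter.1 hQ
    obtain ⟨j, hj⟩ := Int.le.dest (hF Q hQF).1
    have := (hF Q hQF).2
    exact Finset.mem_image.2 ⟨j, by simp; omega, by simp only [hj, hQx]⟩

/-! ### Bounds for the test function. -/

theorem eLpNorm_ennreal {F : (Fin n → ℝ) → ℝ≥0∞} {t : ℝ} (ht : 0 < t) :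
    eLpNorm F (ENNReal.ofReal t) volume = (∫⁻ x, F x ^ t) ^ (1 / t) := by
  rw [eLpNorm_eq_lintegral_rpow_enorm_toReal (by simpa using ht) ENNReal.ofReal_ne_top,
    ENNReal.toReal_ofReal ht.le]
  rfl

theorem eLpNorm_ofReal_rpow {u : (Fin n → ℝ) → ℝ} (hu : ∀ x, 0 ≤ u x) {t b c : ℝ}
    (ht : 0 < t) (hbc : b * t = c) :
    eLpNorm (fun x => ENNReal.ofReal (u x ^ b)) (ENNReal.ofReal t) volume =
      (∫⁻ x, ENNReal.ofReal (u x ^ c)) ^ (1 / t) := by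
  rw [eLpNorm_ennreal ht]
  congr 2 with x
  rw [ENNReal.ofReal_rpow_of_nonneg (Real.rpow_nonneg (hu x) _) ht.le, ← Real.rpow_mul (hu x),
    hbc]

theorem lintegral_cubeAt_lt_top {a : DyadicCube n → ℝ≥0∞} {k : ℤ} (ha : ∀ Q, a Q ≠ ∞)
    {S : Finset (DyadicCube n)} (hS : ∀ Q ∈ S, Q.scale = k)
    (haS : ∀ Q, Q.scale = k → a Q ≠ 0 → Q ∈ S) :
    ∫⁻ x, a (cubeAt k x) < ∞ := by
  have hm : ∀ Q : DyadicCube n, MeasurableSet Q.toSet := fun Q => measurableSet_Icc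
  rw [← lintegral_congr_ae (ae_eq_sum_indicator a hS haS),
    lintegral_finsetSum _ fun Q _ => measurable_const.indicator (hm Q)]
  refine ENNReal.sum_lt_top.2 fun Q _ => ?_
  rw [lintegral_indicator_const (hm Q)]
  exact ENNReal.mul_lt_top (ha Q).lt_top isCompact_Icc.measure_lt_top

theorem enorm_coe_real {𝕜 : Type*} [RCLike 𝕜] (y : ℝ) : ‖(y : 𝕜)‖ₑ = ENNReal.ofReal |y| := by
  rw [← ofReal_norm, RCLike.norm_ofReal]

/-- The maximal function of a step function with values `φ J` of a tree martingale that starts at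
`0` is controlled by any path-increasing majorant of the martingale. -/
theorem dyadicMaximal_le_of_martingale {𝕜 : Type*} [RCLike 𝕜] {f : (Fin n → ℝ) → 𝕜}
    {φ u : ℕ → DyadicCube n → ℝ} {k : ℤ} {J : ℕ} (hφ : ∀ i, φ i = childAverage (φ (i + 1)))
    (hφ₀ : φ 0 = 0) (hu : ∀ i Q, u i Q.parent ≤ u (i + 1) Q) (hφu : ∀ i Q, |φ i Q| ≤ u i Q)
    (hf : f =ᵐ[volume] fun x => (φ J (cubeAt k x) : 𝕜)) :
    ∀ᵐ x : Fin n → ℝ, dyadicMaximal f x ≤ ENNReal.ofReal (u J (cubeAt k x)) := by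
  filter_upwards [ae_mem_toSet_iff (n := n)] with x hx
  have hu' : ∀ j ≤ J, u (J - j) (cubeAt (k + j) x) ≤ u J (cubeAt k x) := by
    intro j hj
    induction j with
    | zero => simp
    | succ j ih =>
      refine le_trans ?_ (ih (by omega))
      have h := hu (J - (j + 1)) (cubeAt (k + j) x)
      rw [parent_cubeAt, add_assoc, show J - (j + 1) + 1 = J - j by omega] at h
      exact_mod_cast h
  refine iSup₂_le fun Q hQ => ?_
  have hQx := (hx Q).1 hQ
  rcases le_total Q.scale k with hk | hk
  · rw [← hQx, dyadicAverage_cubeAt_of_le hf hk, enorm_coe_real]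
    exact ENNReal.ofReal_le_ofReal (hφu _ _)
  · obtain ⟨j, hj⟩ := Int.le.dest hk
    rw [dyadicAverage_eq hf j hj.symm, enorm_coe_real]
    refine ENNReal.ofReal_le_ofReal ?_
    rcases le_total j J with hjJ | hjJ
    · rw [treeAverage_eq_of_martingale (fun i _ => hφ i) hjJ]
      refine (hφu _ _).trans ?_
      rw [← hQx, ← hj]
      exact hu' j hjJ
    -- Above the top generation the averages vanish because `φ 0 = 0`; this cancellation keeps the
    -- maximal function under control far away.
    · obtain ⟨m, rfl⟩ := Nat.exists_eq_add_of_le' hjJ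
      rw [treeAverage_add, treeAverage_eq_of_martingale (fun i _ => hφ i) le_rfl, Nat.sub_self,
        hφ₀, treeAverage_eq_zero m (a := 0) (fun _ _ => rfl), abs_zero]
      exact (abs_nonneg _).trans (hφu _ _)

theorem exists_scale_bounds (F : Finset (DyadicCube n)) :
    ∃ (k : ℤ) (J : ℕ), ∀ Q ∈ F, k ≤ Q.scale ∧ Q.scale < k + J := by
  obtain ⟨k, hk⟩ := (F.image scale).bddBelow
  obtain ⟨M, hM⟩ := (F.image scale).bddAbove
  refine ⟨k, (M + 1 - k).toNat, fun Q hQ => ?_⟩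
  have h1 := hk (Finset.mem_coe.2 (Finset.mem_image_of_mem scale hQ))
  have h2 := hM (Finset.mem_coe.2 (Finset.mem_image_of_mem scale hQ))
  omega

/-- The partial sums of `g`, raised to the power `a + 1`, are controlled by the sum with the
averages of `f` as weights. -/
theorem ancestorSum_rpow_le_dyadicSum {𝕜 : Type*} [RCLike 𝕜] {f : (Fin n → ℝ) → 𝕜}
    {g : DyadicCube n → ℝ≥0} {γ : DyadicCube n → ℝ} (hγ₀ : ∀ Q, 0 ≤ γ Q) (hγ : ∀ Q, γ Q ≤ g Q)
    {φ : ℕ → DyadicCube n → ℝ} {k : ℤ} {J : ℕ} (hγK : ∀ Q, Q.scale = k + J → γ Q = 0)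
    (hφ : ∀ i, φ i = childAverage (φ (i + 1)))
    (hf : f =ᵐ[volume] fun x => (φ J (cubeAt k x) : 𝕜)) {a s : ℝ} (ha : 0 ≤ a) (hs : 0 ≤ s)
    (hφγ : ∀ i < J, ∀ Q, ancestorSum γ (i + 1) Q ^ a ≤ |φ (i + 1) Q| ^ s) (x : Fin n → ℝ) :
    ENNReal.ofReal (ancestorSum γ J (cubeAt k x) ^ (a + 1)) ≤ ENNReal.ofReal (a + 1) *
      dyadicSum (fun Q => ‖dyadicAverage f Q‖ₑ ^ s * (g Q : ℝ≥0∞)) x := by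
  -- Index `i` is scale `k + J - i`. At index `0` the walk is `0` and bounds nothing from below, so
  -- `γ` must vanish there.
  have h1 := rpow_add_one_le_sum (G := fun i => ancestorSum γ i (cubeAt (k + J - i) x))
    (d := fun i => γ (cubeAt (k + J - (i + 1 : ℕ)) x)) ha
    (by simpa [ancestorSum] using hγK _ rfl) (fun i => hγ₀ _) (fun i => by
      simp only [ancestorSum, parent_cubeAt]
      congr 3
      push_cast
      ring) J
  rw [add_sub_cancel_right] at h1
  refine (ENNReal.ofReal_le_ofReal h1).trans ?_
  rw [ENNReal.ofReal_mul (by positivity)]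
  gcongr
  refine le_trans ?_ (sum_cubeAt_le_dyadicSum _ (k + J) J x)
  rw [ENNReal.ofReal_sum_of_nonneg fun i _ => mul_nonneg
    (Real.rpow_nonneg (ancestorSum_nonneg hγ₀ _ _) _) (hγ₀ _)]
  refine Finset.sum_le_sum fun i hi => ?_
  have hi' := Finset.mem_range.1 hi
  rw [ENNReal.ofReal_mul (Real.rpow_nonneg (ancestorSum_nonneg hγ₀ _ _) _)]
  refine mul_le_mul' ?_ ?_
  · rw [dyadicAverage_eq hf (J - (i + 1)) (by simp; omega),
      treeAverage_eq_of_martingale (fun i _ => hφ i) (by omega),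
      Nat.sub_sub_self (by omega), enorm_coe_real,
      ENNReal.ofReal_rpow_of_nonneg (abs_nonneg _) hs]
    exact ENNReal.ofReal_le_ofReal (hφγ i hi' _)
  · rw [← ENNReal.ofReal_coe_nnreal]
    exact ENNReal.ofReal_le_ofReal (hγ _)

/-! ### The estimate for finite families and passage to the limit. -/

theorem eLpNorm_sum_indicator_le {𝕜 : Type*} [RCLike 𝕜] [NeZero n] {p q r s : ℝ}
    (hp : 0 < p) (hq : 0 < q) (hr : 0 < r) (hs : 0 < s) (hpqr : 1 / q = 1 / p + 1 / r)
    {g : DyadicCube n → ℝ≥0} {A : ℝ≥0}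
    (H : ∀ f : (Fin n → ℝ) → 𝕜, IsDyadicStepFunction f → dyadicHardyNorm f (s * p) < ∞ →
        eLpNorm (dyadicSum fun Q => ‖dyadicAverage f Q‖ₑ ^ s * (g Q : ℝ≥0∞))
            (ENNReal.ofReal q) volume
          ≤ (A : ℝ≥0∞) * dyadicHardyNorm f (s * p) ^ s) (F : Finset (DyadicCube n)) :
    eLpNorm (fun x => ∑ Q ∈ F, Q.toSet.indicator (fun _ => (g Q : ℝ≥0∞)) x)
        (ENNReal.ofReal r) volume ≤
      ((Real.toNNReal (r / q) * Real.toNNReal (3 * ((2 : ℝ) ^ n) ^ (2 / (s * p))) ^ s *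
        4 ^ (1 / p) : ℝ≥0) : ℝ≥0∞) * A := by
  classical
  obtain ⟨k, J, hkJ⟩ := exists_scale_bounds F
  set γ : DyadicCube n → ℝ := (F : Set (DyadicCube n)).indicator fun Q => (g Q : ℝ)
  have hγ₀ : ∀ Q, 0 ≤ γ Q := fun Q => Set.indicator_nonneg (fun _ _ => NNReal.coe_nonneg _) _
  have hγg : ∀ Q, γ Q ≤ g Q :=
    fun Q => Set.indicator_le_self' (fun _ _ => NNReal.coe_nonneg _) _
  have hγfin : {Q | γ Q ≠ 0}.Finite :=
    F.finite_toSet.subset fun Q hQ => Set.mem_of_indicator_ne_zero hQ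
  have hγK : ∀ Q, Q.scale = k + J → γ Q = 0 := fun Q hQ =>
    Set.indicator_of_notMem (fun hQF => by have := (hkJ Q hQF).2; omega) _
  have hΓ := ancestorSum_nonneg hγ₀
  have hsp : 0 < s * p := mul_pos hs hp
  -- This `b` gives `(w ^ b) ^ (s p) = w ^ 2` for the norm and `(w ^ b) ^ s = w ^ (2 / p) ≥ Γ ^ (r /
  -- p)` for the averages.
  obtain ⟨w, φ, hw₀, hw₁, hΓw, hwΓ, hφ, hφ₀, hφw, hwφ, T, hT, hsupp⟩ :=
    exists_haarWalk hγ₀ hγfin (b := 2 / (s * p)) (by positivity) hr J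
  set κ : ℝ := 3 * ((2 : ℝ) ^ n) ^ (2 / (s * p))
  have hκ : 0 ≤ κ := by positivity
  set S : Finset (DyadicCube n) :=
    (finite_preimage_iterate_parent hT J).toFinset.filter fun Q => Q.scale = k
  have hS : ∀ Q ∈ S, Q.scale = k := fun Q hQ => (Finset.mem_filter.1 hQ).2
  have hmemS : ∀ Q, Q.scale = k → (ancestorSum γ J Q = 0 ∧ φ J Q = 0 → False) → Q ∈ S := by
    intro Q hQ hne
    refine Finset.mem_filter.2 ⟨?_, hQ⟩
    rw [Set.Finite.mem_toFinset]
    by_contra h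
    exact hne (hsupp Q h)
  set f : (Fin n → ℝ) → 𝕜 :=
    fun x => ∑ Q ∈ S, Q.toSet.indicator (fun _ => (φ J Q : 𝕜)) x
  have hfstep : IsDyadicStepFunction f := ⟨S, fun Q => (φ J Q : 𝕜), rfl⟩
  have hf : f =ᵐ[volume] fun x => (φ J (cubeAt k x) : 𝕜) :=
    ae_eq_sum_indicator (fun Q => (φ J Q : 𝕜)) hS fun Q hQ hne =>
      hmemS Q hQ fun h => hne (by rw [h.2, RCLike.ofReal_zero])
  set I : ℝ≥0∞ := ∫⁻ x : Fin n → ℝ, ENNReal.ofReal (ancestorSum γ J (cubeAt k x) ^ r)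
  have hItop : I < ∞ :=
    lintegral_cubeAt_lt_top (a := fun Q => ENNReal.ofReal (ancestorSum γ J Q ^ r))
      (fun _ => ENNReal.ofReal_ne_top) hS fun Q hQ hne => hmemS Q hQ fun h =>
        hne (by rw [h.1, Real.zero_rpow hr.ne', ENNReal.ofReal_zero])
  -- the Hardy norm of the test function
  have hw4 : ∫⁻ x : Fin n → ℝ, ENNReal.ofReal (w J (cubeAt k x) ^ (2 : ℝ)) ≤ 4 * I := by
    -- The summand `0 * 0` only gives the shape required by `treeAverage_add_mul`.
    have := lintegral_le_of_treeAverage_le (a := fun L => w J L ^ 2)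
      (b := fun L => 4 * ancestorSum γ J L ^ r + 0 * 0) (fun _ => sq_nonneg _)
      (fun L => by have := Real.rpow_nonneg (hΓ J L) r; linarith) J (fun Q => by
        rw [treeAverage_add_mul J (fun L => ancestorSum γ J L ^ r) (fun _ => 0) 4 0 Q]
        simpa using hwΓ Q) k
    simp only [mul_zero, add_zero, ENNReal.ofReal_mul (show (0 : ℝ) ≤ 4 by norm_num)] at this
    rw [lintegral_const_mul' _ _ ENNReal.ofReal_ne_top] at this
    simpa using this
  have hMf : dyadicHardyNorm f (s * p) ≤ (Real.toNNReal κ : ℝ≥0∞) * (4 * I) ^ (1 / (s * p)) := by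
    have h1 := dyadicMaximal_le_of_martingale hφ hφ₀
      (u := fun i Q => κ * w i Q ^ (2 / (s * p)))
      (fun i Q => by
        gcongr
        · exact hw₀ _ _
        · exact hw₁ i Q) hφw hf
    have h2 : dyadicHardyNorm f (s * p) ≤ (Real.toNNReal κ) •
        eLpNorm (fun x => ENNReal.ofReal (w J (cubeAt k x) ^ (2 / (s * p))))
          (ENNReal.ofReal (s * p)) volume := by
      refine eLpNorm_le_nnreal_smul_eLpNorm_of_ae_le_mul' (h1.mono fun x hx => ?_) _
      rw [ENNReal.ofReal_mul hκ] at hx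
      exact hx
    rw [eLpNorm_ofReal_rpow (fun x => hw₀ _ _) hsp (c := 2) (by field_simp)] at h2
    refine h2.trans ?_
    rw [ENNReal.smul_def, smul_eq_mul]
    gcongr
  have hMftop : dyadicHardyNorm f (s * p) < ∞ := by
    refine hMf.trans_lt (ENNReal.mul_lt_top ENNReal.coe_lt_top ?_)
    exact ENNReal.rpow_lt_top_of_nonneg (by positivity)
      (ENNReal.mul_lt_top (by norm_num) hItop).ne
  -- the lower bound for the left-hand side
  have ha1 : r / p + 1 = r / q := by
    have : r / q = r * (1 / q) := by ring
    rw [this, hpqr]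
    field_simp
  have hlow : I ^ (1 / q) ≤ (Real.toNNReal (r / q) : ℝ≥0∞) *
      eLpNorm (dyadicSum fun Q => ‖dyadicAverage f Q‖ₑ ^ s * (g Q : ℝ≥0∞))
        (ENNReal.ofReal q) volume := by
    have h1 := ancestorSum_rpow_le_dyadicSum hγ₀ hγg hγK hφ hf (a := r / p) (by positivity) hs.le
      (fun i hi Q => by
        refine le_trans ?_ (Real.rpow_le_rpow (Real.rpow_nonneg (hw₀ _ _) _) (hwφ i hi Q) hs.le)
        rw [← Real.rpow_mul (hw₀ _ _), show 2 / (s * p) * s = 2 / p by field_simp]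
        refine le_trans (le_of_eq ?_) (Real.rpow_le_rpow (Real.rpow_nonneg (hΓ _ _) _)
          (hΓw (i + 1) hi Q) (by positivity))
        rw [← Real.rpow_mul (hΓ _ _)]
        congr 1
        field_simp)
    rw [ha1] at h1
    have h2 := eLpNorm_le_nnreal_smul_eLpNorm_of_ae_le_mul' (μ := (volume : Measure (Fin n → ℝ)))
      (f := fun x => ENNReal.ofReal (ancestorSum γ J (cubeAt k x) ^ (r / q)))
      (g := dyadicSum fun Q => ‖dyadicAverage f Q‖ₑ ^ s * (g Q : ℝ≥0∞))
      (c := Real.toNNReal (r / q)) (Filter.Eventually.of_forall h1) (ENNReal.ofReal q)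
    rw [eLpNorm_ofReal_rpow (fun x => hΓ _ _) hq (c := r) (by field_simp), ENNReal.smul_def,
      smul_eq_mul] at h2
    exact h2
  -- conclusion
  have hfinal : I ^ (1 / r) ≤ ((Real.toNNReal (r / q) * Real.toNNReal κ ^ s *
      4 ^ (1 / p) : ℝ≥0) : ℝ≥0∞) * A := by
    -- Dividing by `I ^ (1 / p)` needs `I` nonzero and finite; finiteness comes from the finite
    -- family.
    rcases eq_or_ne I 0 with h0 | h0
    · rw [h0, ENNReal.zero_rpow_of_pos (by positivity)]
      exact zero_le
    have h3 : I ^ (1 / p) ≠ 0 := by simp [h0, hItop.ne]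
    have h4 : I ^ (1 / p) ≠ ∞ := ENNReal.rpow_ne_top_of_nonneg (by positivity) hItop.ne
    rw [← ENNReal.mul_le_mul_iff_right h3 h4, ← ENNReal.rpow_add _ _ h0 hItop.ne, ← hpqr]
    calc I ^ (1 / q) ≤ (Real.toNNReal (r / q) : ℝ≥0∞) *
          (A * ((Real.toNNReal κ : ℝ≥0∞) * (4 * I) ^ (1 / (s * p))) ^ s) := by
          refine hlow.trans ?_
          gcongr
          refine (H f hfstep hMftop).trans ?_
          gcongr
      _ = _ := by
          rw [ENNReal.mul_rpow_of_nonneg _ _ hs.le, ← ENNReal.rpow_mul,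
            show 1 / (s * p) * s = 1 / p by field_simp,
            ENNReal.mul_rpow_of_nonneg _ _ (by positivity : 0 ≤ 1 / p)]
          push_cast
          rw [ENNReal.coe_rpow_of_nonneg _ hs.le,
            ENNReal.coe_rpow_of_nonneg _ (by positivity : 0 ≤ 1 / p), ENNReal.coe_ofNat]
          ring
  refine le_trans ?_ hfinal
  rw [← eLpNorm_ofReal_rpow (b := 1) (fun x => hΓ _ _) hr (one_mul r)]
  refine eLpNorm_mono_enorm_ae ?_
  filter_upwards [sum_indicator_le_ancestorSum (g := g) fun Q hQ =>
    ⟨(hkJ Q hQ).1, (hkJ Q hQ).2.le⟩] with x hx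
  simpa using hx

/-- The `L ^ t` quasi-norm of an infinite sum over cubes is bounded by those of its finite
partial sums. -/
theorem eLpNorm_dyadicSum_le {a : DyadicCube n → ℝ≥0∞} {t : ℝ} (ht : 0 < t) {B : ℝ≥0∞}
    (h : ∀ F : Finset (DyadicCube n),
      eLpNorm (fun x => ∑ Q ∈ F, Q.toSet.indicator (fun _ => a Q) x)
        (ENNReal.ofReal t) volume ≤ B) :
    eLpNorm (dyadicSum a) (ENNReal.ofReal t) volume ≤ B := by
  have hm : ∀ Q : DyadicCube n, MeasurableSet Q.toSet := fun Q => measurableSet_Icc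
  simp only [eLpNorm_ennreal ht, one_div, ENNReal.rpow_inv_le_iff ht] at h ⊢
  have hsup : ∀ x, dyadicSum a x ^ t =
      ⨆ F : Finset (DyadicCube n), (∑ Q ∈ F, Q.toSet.indicator (fun _ => a Q) x) ^ t := by
    intro x
    rw [dyadicSum, ENNReal.tsum_eq_iSup_sum]
    -- The power `t` commutes with suprema, so monotone convergence applies without a triangle
    -- inequality, also for `t < 1`.
    exact (ENNReal.orderIsoRpow t ht).map_iSup _
  simp only [hsup]
  rw [lintegral_iSup_directed]
  · exact iSup_le h
  · intro F
    exact ((Finset.measurable_sum _ fun Q _ =>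
      measurable_const.indicator (hm Q)).pow_const t).aemeasurable
  · refine Monotone.directed_le fun F F' hF x => ?_
    exact ENNReal.rpow_le_rpow (Finset.sum_le_sum_of_subset hF) ht.le

end DyadicCube

theorem mainTheorem3 (𝕜 : Type*) [RCLike 𝕜] (n : ℕ) (hn : 0 < n) (p q r s : ℝ)
    (hp : 0 < p) (hq : 0 < q) (hr : 0 < r) (hs : 0 < s) (hpqr : 1 / q = 1 / p + 1 / r) :
    ∃ C : ℝ≥0, ∀ (g : DyadicCube n → ℝ≥0) (A : ℝ≥0),
      (∀ f : (Fin n → ℝ) → 𝕜, IsDyadicStepFunction f → dyadicHardyNorm f (s * p) < ∞ →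
        eLpNorm (dyadicSum fun Q => ‖dyadicAverage f Q‖ₑ ^ s * (g Q : ℝ≥0∞))
            (ENNReal.ofReal q) volume
          ≤ (A : ℝ≥0∞) * dyadicHardyNorm f (s * p) ^ s) →
      eLpNorm (dyadicSum fun Q => (g Q : ℝ≥0∞)) (ENNReal.ofReal r) volume
        ≤ (C : ℝ≥0∞) * (A : ℝ≥0∞) := by
  have : NeZero n := ⟨hn.ne'⟩
  exact ⟨_, fun g A H => DyadicCube.eLpNorm_dyadicSum_le hr fun F =>
    DyadicCube.eLpNorm_sum_indicator_le hp hq hr hs hpqr H F⟩
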